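/- Let $G=(V,E)$ be a finite simple unweighted undirected graph, $n=|V|$, with Laplacian $L$. For $u,v\in V$ let $R^G_{uv}$ be the effective resistance, i.e. $\varphi(u)-\varphi(v)$ for any $\varphi\in\mathbb R^V$ with $L\varphi=\chi_u-\chi_v$, and $R^G_{uv}=\infty$ if $u,v$ lie in different connected components of $G$. For $S\subseteq V$ let $\mathrm{diam}_{\rm eff}(S)=\max_{u,v\in S}R^G_{uv}$ and $\mathrm{diam}^{\rm Ind}_{\rm eff}(S)=\max_{u,v\in S}R^{G[S]}_{uv}$, where $G[S]$ is the subgraph induced on $S$. The connectivity of an edge $\{u,v\}$ is the minimum number of edges in a cut of $G$ separating $u$ from $v$. For $E'\subseteq E$, a radius $r>0$ and an ordering $\pi$ of $V$, the algorithm BallCarving with the effective resistance metric of $G$ works as follows. Start with $V_{\rm active}=V'=V$. While $V_{\rm active}\neq\emptyset$, let $u$ be the first vertex of $V_{\rm active}$ in the order $\pi$ and let $C^*$ be the connected component of $(V,E\setminus E')$ containing $u$. If $\max_{v\in C^*}R^G_{uv}\le r/2$, remove $C^*$ from $V_{\rm active}$. Otherwise output the set $P=\{u\}\cup\{v\in V':R^G_{uv}\le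 r\}$ and remove $P$ from both $V_{\rm active}$ and $V'$. There are universal constants $K,c$ such that the following holds for every such $G$, every $E'\subseteq E$ and every ordering $\pi$ of $V$. Assume: 1. the minimum degree of $G$ is at least $d$, where $d\ge 1$; 2. for some $0<\beta<1/\log n$, some integer $k\ge1$ and some $\Delta\in(0,1)$ with $\Delta<\frac{\beta}{400\sqrt k}$, the vertex set has a partition $V=C_1\cup\dots\cup C_k$ with $\mathrm{diam}^{\rm Ind}_{\rm eff}(C_i)\le\Delta$ for all $i$; 3. $E'$ contains every edge of $G$ whose connectivity in $G$ is at most $d$. Then BallCarving with edge set $E'$, radius $\beta$ and the effective resistance metric of $G$ returns pairwise disjoint sets $P_1,P_2,\dots$ with $\mathrm{diam}_{\rm eff}(P_i)\le2\beta$ for all $i$, and the number of non-singleton sets among them is $\widetilde O\big(\sqrt k+\frac{k}{\beta d}\big)$, that is, at most $K(\log n)^{c}\big(\sqrt k+\frac{k}{\beta d}\big)$. -/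

import Mathlib

open scoped ENNReal

noncomputable section

/-- `φ` is a vector of potentials on the vertices of the unweighted graph `G` induced by injecting
one unit of current at `u` and extracting it at `v`: `L φ = χ_u - χ_v`, with `L` the Laplacian. -/
def IsUnitPotential {V : Type*} [Fintype V] (G : SimpleGraph V) (u v : V) (φ : V → ℝ) : Prop :=
  open Classical in
  (G.lapMatrix ℝ).mulVec φ = Pi.single u 1 - Pi.single v 1

/-- The effective resistance `R_{uv}^G`: the potential difference `φ u - φ v` when one unit of
current is injected at `u` and extracted at `v`. All potentials `φ` give the same difference (see
`effRes_eq`), so the infimum only selects that common value; if no current can flow from `u` to `v`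
(different connected components) there is no such `φ` and the resistance is `∞`. -/
def effRes {V : Type*} [Fintype V] (G : SimpleGraph V) (u v : V) : ℝ≥0∞ :=
  ⨅ (φ : V → ℝ) (_ : IsUnitPotential G u v φ), ENNReal.ofReal (φ u - φ v)

/-- The effective resistance is the potential difference of any unit potential. -/
theorem effRes_eq {V : Type*} [Fintype V] (G : SimpleGraph V) (u v : V) (φ : V → ℝ)
    (hφ : IsUnitPotential G u v φ) : effRes G u v = ENNReal.ofReal (φ u - φ v) := by
  classical
  have key : ∀ ψ : V → ℝ, IsUnitPotential G u v ψ → ψ u - ψ v = φ u - φ v := by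
    intro ψ hψ
    unfold IsUnitPotential at hφ hψ
    have hs := (SimpleGraph.isSymm_lapMatrix (R := ℝ) G)
    have e : ∀ x y : V → ℝ, dotProduct x ((G.lapMatrix ℝ).mulVec y)
        = dotProduct y ((G.lapMatrix ℝ).mulVec x) := by
      intro x y
      rw [Matrix.dotProduct_mulVec, ← Matrix.mulVec_transpose, hs.eq, dotProduct_comm]
    have h := e ψ φ
    have h1 : (G.lapMatrix ℝ).mulVec φ = Pi.single u 1 - Pi.single v 1 := by
      convert hφ
    have h2 : (G.lapMatrix ℝ).mulVec ψ = Pi.single u 1 - Pi.single v 1 := by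
      convert hψ
    rw [h1, h2] at h
    simpa [dotProduct_sub] using h
  unfold effRes
  apply le_antisymm
  · exact iInf₂_le φ hφ
  · refine le_iInf₂ fun ψ hψ => ?_
    rw [key ψ hψ]

/-- `diam_eff(S)`: the effective resistance diameter of `S` in the metric of `G`. -/
def effDiam {V : Type*} [Fintype V] (G : SimpleGraph V) (S : Finset V) : ℝ≥0∞ :=
  ⨆ u ∈ S, ⨆ v ∈ S, effRes G u v

/-- `diam_eff^Ind(S)`: the effective resistance diameter of the subgraph of `G` induced on `S`. -/
def inducedEffDiam {V : Type*} (G : SimpleGraph V) (S : Finset V) : ℝ≥0∞ :=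
  ⨆ (u : (S : Set V)) (v : (S : Set V)), effRes (G.induce (S : Set V)) u v

/-- The connectivity of the pair `u, v` (meant for distinct vertices): the minimum, over all vertex
sets `S` containing `u` but not `v`, of the number of edges of `G` leaving `S`. -/
def edgeConnectivity {V : Type*} [Fintype V] (G : SimpleGraph V) (u v : V) : ℕ :=
  open Classical in
  sInf {m : ℕ | ∃ S : Finset V, u ∈ S ∧ v ∉ S ∧ m = (G.interedges S Sᶜ).card}

/-- The vertex set of the connected component of `u` in `(V, E \ E')`. -/
def componentAvoiding {V : Type*} [Fintype V] (G : SimpleGraph V) (E' : Set (Sym2 V)) (u : V) :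
    Finset V :=
  open Classical in
  Finset.univ.filter fun v => (G.deleteEdges E').Reachable u v

/-- The main loop of `BallCarving`. The list argument is the ordered set `V_active`,
the finite set is the set `V'` of vertices that have not been output so far. If every vertex of the
component `comp u` of the next active vertex `u` is at distance at most `r / 2` from `u`, the whole
component is made inactive; otherwise the ball of radius `r` around `u` in `V'` is output, and its
vertices leave both `V_active` and `V'`. -/
def carve {V : Type*} [DecidableEq V] (comp : V → Finset V) (r : ℝ) (R : V → V → ℝ≥0∞) :
    List V → Finset V → List (Finset V)
  | [], _ => []
  | u :: L, V' =>
    open Classical in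
    if (comp u).sup (R u) ≤ ENNReal.ofReal (r / 2) then
      carve comp r R (L.filter fun w => w ∉ comp u) V'
    else
      let P : Finset V := insert u (V'.filter fun w => R u w ≤ ENNReal.ofReal r)
      P :: carve comp r R (L.filter fun w => w ∉ P) (V' \ P)
  termination_by L => L.length
  decreasing_by
    all_goals
      simp only [List.length_cons, List.length_unattach]
      exact Nat.lt_succ_of_le ((List.length_filter_le _ _).trans (List.length_attach).le)

/-- `BallCarving` with input graph `G`, edge set `E'`, radius `r` and distance `R`, going through
the vertices in the order of the list `order`; it returns the sequence `P₁, P₂, …`. -/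
def ballCarving {V : Type*} [Fintype V] [DecidableEq V] (G : SimpleGraph V) (E' : Set (Sym2 V))
    (r : ℝ) (R : V → V → ℝ≥0∞) (order : List V) : List (Finset V) :=
  carve (componentAvoiding G E') r R order Finset.univ

end

/-! ### Gradients and effective resistance -/

section Resistance

variable {V : Type*}

/-! The centres of the output balls are pairwise more than `β` apart. Each centre `u` has a vertex
`v` with resistance above `β / 2` that is reachable from `u` outside `E'`, so every cut separating
the two has more than `d` edges. Choose one representative per cluster and count, for each centre,
the representatives of the vertices in its ball of radius `β / 4`. These sets are disjoint for
different centres, so at most `√k` centres have `√k` or more of them.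

Around any other centre, sweep a threshold `t` over `[0, β / 4)` and look at the cut of vertices at
resistance at most `t`. A crossing edge of resistance at most `16 * Δ` forces `t` into an interval
of length `18 * Δ` attached to a nearby representative. Fewer than `√k` such intervals cover length
at most `β / 8`. For all other `t`, at least `d` long edges cross, and an edge crosses for a set of
`t` of length at most its resistance. Integration shows that the long edges starting in the ball
have total resistance at least `d * (β / 8)` (`mul_le_sum_effRes_near`).

The long edges of the whole graph have total resistance at most `8 * k`
(`sum_effRes_long_edges_le`). Moving the ends of a long edge to their representatives changes its
potential gradient by at most half its norm, and puts it in a space of dimension at most `k`, where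
Foster's trace argument applies. Hence there are at most `64 * k / (β * d)` centres of the second
kind (`card_centers_le`). -/

open Classical in
/-- The gradient of a vertex function, indexed by ordered pairs and zero off the edges. -/
noncomputable def SimpleGraph.gradient (G : SimpleGraph V) :
    (V → ℝ) →ₗ[ℝ] EuclideanSpace ℝ (V × V) where
  toFun ψ := WithLp.toLp 2 fun p => if G.Adj p.1 p.2 then ψ p.1 - ψ p.2 else 0
  map_add' φ ψ := by
    ext p
    by_cases h : G.Adj p.1 p.2 <;> simp [h]
    ring
  map_smul' a φ := by
    ext p
    by_cases h : G.Adj p.1 p.2 <;> simp [h]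
    ring

variable {G : SimpleGraph V} {u v w : V} {φ ψ : V → ℝ}

open Classical in
theorem gradient_apply (ψ : V → ℝ) (p : V × V) :
    G.gradient ψ p = if G.Adj p.1 p.2 then ψ p.1 - ψ p.2 else 0 := rfl

theorem gradient_apply_of_adj (h : G.Adj u v) (ψ : V → ℝ) : G.gradient ψ (u, v) = ψ u - ψ v := by
  simp [gradient_apply, h]

variable [Fintype V]

open Classical in
theorem inner_gradient (φ ψ : V → ℝ) :
    inner ℝ (G.gradient φ) (G.gradient ψ)
      = 2 * dotProduct ψ ((G.lapMatrix ℝ).mulVec φ) := by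
  have h1 : ∀ a, ((G.lapMatrix ℝ).mulVec φ) a = ∑ b, if G.Adj a b then φ a - φ b else 0 := by
    intro a
    rw [SimpleGraph.lapMatrix_mulVec_apply, SimpleGraph.degree_eq_sum_if_adj,
      SimpleGraph.neighborFinset_eq_filter, Finset.sum_filter, Finset.sum_mul,
      ← Finset.sum_sub_distrib]
    refine Finset.sum_congr rfl fun b _ => ?_
    split_ifs <;> simp
  simp only [PiLp.inner_apply, gradient_apply, dotProduct, h1, Fintype.sum_prod_type,
    RCLike.inner_apply, conj_trivial, Finset.mul_sum]
  have h2 : ∑ a, ∑ b, ψ b * (if G.Adj a b then φ a - φ b else 0)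
      = - ∑ a, ∑ b, ψ a * (if G.Adj a b then φ a - φ b else 0) := by
    rw [Finset.sum_comm, ← Finset.sum_neg_distrib]
    refine Finset.sum_congr rfl fun a _ => ?_
    rw [← Finset.sum_neg_distrib]
    refine Finset.sum_congr rfl fun b _ => ?_
    by_cases h : G.Adj a b
    · simp [h, h.symm]; ring
    · have h' : ¬ G.Adj b a := fun h' => h h'.symm
      simp [h, h']
  have h3 : ∑ a, ∑ b, ((if G.Adj a b then ψ a - ψ b else 0)
        * (if G.Adj a b then φ a - φ b else 0))
      = ∑ a, ∑ b, ψ a * (if G.Adj a b then φ a - φ b else 0)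
        - ∑ a, ∑ b, ψ b * (if G.Adj a b then φ a - φ b else 0) := by
    simp only [← Finset.sum_sub_distrib]
    refine Finset.sum_congr rfl fun a _ => Finset.sum_congr rfl fun b _ => ?_
    split_ifs <;> ring
  rw [h3, h2]
  simp only [← Finset.mul_sum]
  ring

/-- The weak form of the Laplace equation, by summation by parts. Each edge contributes two
coordinates, one per orientation, which is the source of the factor 2 here and in the energy
identities below. -/
theorem isUnitPotential_iff :
    IsUnitPotential G u v φ ↔
      ∀ ψ : V → ℝ, inner ℝ (G.gradient φ) (G.gradient ψ) = 2 * (ψ u - ψ v) := by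
  classical
  unfold IsUnitPotential
  constructor
  · intro h ψ
    rw [inner_gradient]
    convert congrArg (fun x => 2 * dotProduct ψ x) h using 2
    simp [dotProduct_sub]
  · intro h
    ext a
    have h1 := h (Pi.single a 1)
    rw [inner_gradient] at h1
    have h2 := mul_left_cancel₀ (two_ne_zero) h1
    rw [single_one_dotProduct] at h2
    convert h2 using 1
    simp [Pi.single_apply, eq_comm]

theorem IsUnitPotential.sub_eq (h : IsUnitPotential G u v φ) :
    2 * (φ u - φ v) = ‖G.gradient φ‖ ^ 2 := by
  rw [← isUnitPotential_iff.1 h φ, real_inner_self_eq_norm_sq]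

theorem IsUnitPotential.sub_nonneg (h : IsUnitPotential G u v φ) : 0 ≤ φ u - φ v := by
  have := h.sub_eq
  nlinarith [sq_nonneg ‖G.gradient φ‖]

theorem IsUnitPotential.toReal_effRes (h : IsUnitPotential G u v φ) :
    (effRes G u v).toReal = φ u - φ v := by
  rw [effRes_eq G u v φ h, ENNReal.toReal_ofReal h.sub_nonneg]

theorem IsUnitPotential.norm_sq (h : IsUnitPotential G u v φ) :
    ‖G.gradient φ‖ ^ 2 = 2 * (effRes G u v).toReal := by
  rw [h.toReal_effRes, h.sub_eq]

theorem exists_isUnitPotential (h : effRes G u v ≠ ⊤) : ∃ φ, IsUnitPotential G u v φ := by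
  by_contra! h'
  exact h (by simp [effRes, h'])

theorem IsUnitPotential.add {φ ψ : V → ℝ} (h : IsUnitPotential G u v φ)
    (h' : IsUnitPotential G v w ψ) : IsUnitPotential G u w (φ + ψ) := by
  rw [isUnitPotential_iff] at *
  intro χ
  rw [map_add, inner_add_left, h, h']
  ring

theorem IsUnitPotential.neg (h : IsUnitPotential G u v φ) : IsUnitPotential G v u (-φ) := by
  rw [isUnitPotential_iff] at *
  intro χ
  rw [map_neg, inner_neg_left, h]
  ring

theorem effRes_self (u : V) : effRes G u u = 0 := by
  rw [effRes_eq G u u 0 (isUnitPotential_iff.2 (by simp))]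
  simp

theorem effRes_comm (u v : V) : effRes G u v = effRes G v u := by
  have key : ∀ u v : V, effRes G u v ≤ effRes G v u := by
    intro u v
    by_cases h : effRes G v u = ⊤
    · simp [h]
    · obtain ⟨φ, hφ⟩ := exists_isUnitPotential h
      rw [effRes_eq _ _ _ _ hφ, effRes_eq _ _ _ _ hφ.neg]
      simp [neg_add_eq_sub]
  exact le_antisymm (key u v) (key v u)

/-- A criterion for the existence of a unit potential. -/
theorem exists_isUnitPotential_of_forall
    (h : ∀ ψ : V → ℝ, G.gradient ψ = 0 → ψ u = ψ v) : ∃ φ, IsUnitPotential G u v φ := by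
  -- The difference functional vanishes on the kernel of the gradient, so it descends to the range,
  -- where Riesz representation produces the potential.
  let f : (V → ℝ) →ₗ[ℝ] ℝ :=
    LinearMap.proj (R := ℝ) (φ := fun _ : V => ℝ) u - LinearMap.proj (R := ℝ) (φ := fun _ : V => ℝ) v
  have hf : LinearMap.ker G.gradient ≤ LinearMap.ker f := by
    intro ψ hψ
    simpa [f, sub_eq_zero] using h ψ hψ
  obtain ⟨g, hg⟩ : ∃ g : (LinearMap.range G.gradient) →ₗ[ℝ] ℝ,
      ∀ ψ, g ⟨G.gradient ψ, LinearMap.mem_range_self _ ψ⟩ = f ψ := by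
    refine ⟨((LinearMap.ker G.gradient).liftQ f hf) ∘ₗ
      G.gradient.quotKerEquivRange.symm.toLinearMap, fun ψ => ?_⟩
    have : G.gradient.quotKerEquivRange.symm ⟨G.gradient ψ, LinearMap.mem_range_self _ ψ⟩
        = (LinearMap.ker G.gradient).mkQ ψ := by
      rw [LinearEquiv.symm_apply_eq]
      ext1
      simp
    simp [this]
  obtain ⟨x, hx⟩ := (InnerProductSpace.toDual ℝ (LinearMap.range G.gradient)).surjective
    (LinearMap.toContinuousLinearMap g)
  obtain ⟨φ, hφ⟩ := x.2
  refine ⟨(2 : ℝ) • φ, isUnitPotential_iff.2 fun ψ => ?_⟩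
  have h1 := congrArg (fun l => l ⟨G.gradient ψ, LinearMap.mem_range_self _ ψ⟩) hx
  simp only [InnerProductSpace.toDual_apply_apply, LinearMap.coe_toContinuousLinearMap', hg,
    Submodule.coe_inner, ← hφ] at h1
  rw [map_smul, inner_smul_left, h1]
  simp [f]

/-- The variational characterization of effective resistance. -/
theorem effRes_le_ofReal_iff {c : ℝ} (hc : 0 ≤ c) :
    effRes G u v ≤ ENNReal.ofReal c ↔
      ∀ ψ : V → ℝ, 2 * (ψ u - ψ v) ^ 2 ≤ c * ‖G.gradient ψ‖ ^ 2 := by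
  constructor
  · intro h ψ
    obtain ⟨φ, hφ⟩ := exists_isUnitPotential (ne_top_of_le_ne_top ENNReal.ofReal_ne_top h)
    rw [effRes_eq G u v φ hφ, ENNReal.ofReal_le_ofReal_iff hc] at h
    have h1 := isUnitPotential_iff.1 hφ ψ
    have h2 := abs_real_inner_le_norm (G.gradient φ) (G.gradient ψ)
    have h3 := sq_le_sq' (by linarith [(abs_le.1 h2).1]) (abs_le.1 h2).2
    rw [h1, mul_pow ‖_‖, ← hφ.sub_eq] at h3
    nlinarith [mul_le_mul_of_nonneg_right h (sq_nonneg ‖G.gradient ψ‖)]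
  · intro h
    obtain ⟨φ, hφ⟩ := exists_isUnitPotential_of_forall (G := G) (u := u) (v := v) fun ψ hψ => by
      have := h ψ
      rw [hψ] at this
      have h0 : (ψ u - ψ v) ^ 2 = 0 :=
        le_antisymm (by rw [norm_zero] at this; linarith) (sq_nonneg _)
      exact sub_eq_zero.1 (pow_eq_zero_iff two_ne_zero |>.1 h0)
    rw [effRes_eq G u v φ hφ, ENNReal.ofReal_le_ofReal_iff hc]
    -- Testing on the potential itself gives `R ^ 2 ≤ c * R` for `R = φ u - φ v`.
    have h1 := h φ
    rw [← hφ.sub_eq] at h1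
    by_contra! h2
    nlinarith [mul_pos (lt_of_le_of_lt hc h2) (sub_pos.2 h2)]

theorem effRes_le_one_of_adj (h : G.Adj u v) : effRes G u v ≤ 1 := by
  rw [← ENNReal.ofReal_one, effRes_le_ofReal_iff zero_le_one]
  intro ψ
  have hne : (u, v) ≠ (v, u) := fun e => h.ne (Prod.ext_iff.1 e).1
  classical
  rw [EuclideanSpace.norm_sq_eq, one_mul]
  calc 2 * (ψ u - ψ v) ^ 2 = ∑ p ∈ {(u, v), (v, u)}, ‖G.gradient ψ p‖ ^ 2 := by
        rw [Finset.sum_pair hne, gradient_apply_of_adj h, gradient_apply_of_adj h.symm]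
        simp only [Real.norm_eq_abs, sq_abs]
        ring
    _ ≤ _ := Finset.sum_le_sum_of_subset_of_nonneg (Finset.subset_univ _)
        fun _ _ _ => sq_nonneg _

theorem effRes_ne_top_of_adj (h : G.Adj u v) : effRes G u v ≠ ⊤ :=
  ne_top_of_le_ne_top ENNReal.one_ne_top (effRes_le_one_of_adj h)

/-- Unit potentials satisfy the maximum principle. -/
theorem IsUnitPotential.mem_Icc (h : IsUnitPotential G u v φ)
    (hw : ∀ ψ : V → ℝ, G.gradient ψ = 0 → ψ u = ψ w) : φ w ∈ Set.Icc (φ v) (φ u) := by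
  have huv := h.sub_nonneg
  -- Clamping `φ` between its values at `v` and `u` does not increase the energy. Since `φ`
  -- minimises energy for these boundary values, the clamped function has the same gradient.
  set ψ : V → ℝ := fun x => max (φ v) (min (φ u) (φ x)) with hψ
  have hu : ψ u = φ u := by simp [hψ]; linarith
  have hv : ψ v = φ v := by simp [hψ]
  have hle : ‖G.gradient ψ‖ ^ 2 ≤ ‖G.gradient φ‖ ^ 2 := by
    rw [EuclideanSpace.norm_sq_eq, EuclideanSpace.norm_sq_eq]
    refine Finset.sum_le_sum fun p _ => ?_
    rw [gradient_apply, gradient_apply]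
    split_ifs with hp
    · rw [Real.norm_eq_abs, Real.norm_eq_abs]
      refine pow_le_pow_left₀ (abs_nonneg _) ?_ 2
      have h1 := abs_max_sub_max_le_max (φ v) (min (φ u) (φ p.1)) (φ v) (min (φ u) (φ p.2))
      have h2 := abs_min_sub_min_le_max (φ u) (φ p.1) (φ u) (φ p.2)
      rw [sub_self, abs_zero] at h1 h2
      exact (h1.trans (max_eq_right (abs_nonneg _)).le).trans
        (h2.trans (max_eq_right (abs_nonneg _)).le)
    · simp
  have hin := isUnitPotential_iff.1 h ψ
  rw [hu, hv, h.sub_eq] at hin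
  have h0 : ‖G.gradient (φ - ψ)‖ ^ 2 = 0 := by
    refine le_antisymm ?_ (sq_nonneg _)
    rw [map_sub, norm_sub_sq_real, hin]
    linarith
  have h1 := hw (φ - ψ) (by simpa using h0)
  simp only [Pi.sub_apply, hu, sub_self] at h1
  have h2 : φ w = ψ w := by linarith
  rw [h2]
  exact ⟨le_max_left _ _, max_le (by linarith) (min_le_left _ _)⟩

theorem IsUnitPotential.eq_of_gradient_eq_zero (h : IsUnitPotential G u v φ)
    (hψ : G.gradient ψ = 0) : ψ u = ψ v := by
  have := isUnitPotential_iff.1 h ψ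
  rw [hψ, inner_zero_right] at this
  linarith

/-- By superposition, the sum of the two potentials is a unit potential from `u` to `w`. The maximum
principle gives `φ v ≤ φ w` and `ψ u ≤ ψ v`, which compares the drops. -/
theorem effRes_triangle (u v w : V) : effRes G u w ≤ effRes G u v + effRes G v w := by
  by_cases h1 : effRes G u v = ⊤
  · simp [h1]
  by_cases h2 : effRes G v w = ⊤
  · simp [h2]
  obtain ⟨φ, hφ⟩ := exists_isUnitPotential h1
  obtain ⟨ψ, hψ⟩ := exists_isUnitPotential h2
  rw [effRes_eq _ _ _ _ hφ, effRes_eq _ _ _ _ hψ, effRes_eq _ _ _ _ (hφ.add hψ),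
    ← ENNReal.ofReal_add hφ.sub_nonneg hψ.sub_nonneg]
  apply ENNReal.ofReal_le_ofReal
  have h3 := (hφ.mem_Icc (w := w) fun χ hχ =>
    (hφ.eq_of_gradient_eq_zero hχ).trans (hψ.eq_of_gradient_eq_zero hχ)).1
  have h4 := (hψ.mem_Icc (w := u) fun χ hχ => (hφ.eq_of_gradient_eq_zero hχ).symm).2
  simp only [Pi.add_apply]
  linarith

/-- Rayleigh monotonicity for induced subgraphs. -/
theorem effRes_le_effRes_induce (G : SimpleGraph V) (S : Set V) [Fintype S] (u v : S) :
    effRes G u v ≤ effRes (G.induce S) u v := by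
  classical
  by_cases h : effRes (G.induce S) u v = ⊤
  · simp [h]
  have hc := ENNReal.toReal_nonneg (a := effRes (G.induce S) u v)
  have h1 : effRes (G.induce S) u v ≤ ENNReal.ofReal (effRes (G.induce S) u v).toReal := by
    rw [ENNReal.ofReal_toReal h]
  rw [← ENNReal.ofReal_toReal h, effRes_le_ofReal_iff hc]
  rw [effRes_le_ofReal_iff hc] at h1
  intro ψ
  -- Restricting a test function to `S` only discards coordinates of its gradient.
  refine (h1 fun x => ψ x).trans (mul_le_mul_of_nonneg_left ?_ hc)
  rw [EuclideanSpace.norm_sq_eq, EuclideanSpace.norm_sq_eq]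
  calc _ = ∑ p : S × S, ‖G.gradient ψ ((p.1 : V), (p.2 : V))‖ ^ 2 := rfl
    _ = ∑ p ∈ Finset.univ.image (fun p : S × S => ((p.1 : V), (p.2 : V))),
          ‖G.gradient ψ p‖ ^ 2 := by
        rw [Finset.sum_image]
        rintro ⟨a, b⟩ - ⟨c, d⟩ - h
        simpa [Subtype.ext_iff] using h
    _ ≤ _ := Finset.sum_le_sum_of_subset_of_nonneg (Finset.subset_univ _)
        fun _ _ _ => sq_nonneg _

theorem effRes_le_inducedEffDiam (G : SimpleGraph V) {C : Finset V} (hu : u ∈ C) (hv : v ∈ C) :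
    effRes G u v ≤ inducedEffDiam G C :=
  (effRes_le_effRes_induce G (C : Set V) ⟨u, hu⟩ ⟨v, hv⟩).trans
    (le_iSup₂ (f := fun (a b : (C : Set V)) => effRes (G.induce (C : Set V)) a b)
      ⟨u, hu⟩ ⟨v, hv⟩)

end Resistance

/-! ### A Foster type bound for the long edges between clusters -/

section Foster

variable {V : Type*} [Fintype V] {G : SimpleGraph V}

open Classical in
/-- Gradients of the functions that are harmonic outside `S`. -/
noncomputable def SimpleGraph.harmonicGradients (G : SimpleGraph V) (S : Finset V) :
    Submodule ℝ (EuclideanSpace ℝ (V × V)) where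
  carrier := {g | g ∈ LinearMap.range G.gradient ∧
    ∀ v ∉ S, inner ℝ (G.gradient (Pi.single v 1)) g = 0}
  add_mem' := fun {a b} ha hb => ⟨add_mem ha.1 hb.1, fun v hv => by
    rw [inner_add_right, ha.2 v hv, hb.2 v hv, add_zero]⟩
  zero_mem' := ⟨zero_mem _, fun v _ => inner_zero_right _⟩
  smul_mem' := fun c g hg => ⟨Submodule.smul_mem _ c hg.1, fun v hv => by
    rw [inner_smul_right, hg.2 v hv, mul_zero]⟩

/-- Such a gradient is determined by its divergence on `S`: if that vanishes too, the gradient is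
orthogonal to the gradients of all indicators, hence to itself. -/
theorem finrank_harmonicGradients_le (S : Finset V) :
    Module.finrank ℝ (G.harmonicGradients S) ≤ S.card := by
  classical
  let f : EuclideanSpace ℝ (V × V) →ₗ[ℝ] (S → ℝ) :=
    LinearMap.pi fun s => (innerₛₗ ℝ (G.gradient (Pi.single (s : V) 1)))
  have hinj : Function.Injective (f ∘ₗ (G.harmonicGradients S).subtype) := by
    rw [← LinearMap.ker_eq_bot, LinearMap.ker_eq_bot']
    rintro ⟨g, ⟨ψ, rfl⟩, hg⟩ h0
    have h1 : ∀ v, inner ℝ (G.gradient (Pi.single v 1)) (G.gradient ψ) = 0 := by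
      intro v
      by_cases hv : v ∈ S
      · exact congrFun h0 ⟨v, hv⟩
      · convert hg v hv
    have h2 : inner ℝ (G.gradient ψ) (G.gradient ψ) = 0 := by
      conv_lhs =>
        arg 2
        rw [← Finset.univ_sum_single ψ]
      rw [map_sum, sum_inner]
      refine Finset.sum_eq_zero fun v _ => ?_
      have : Pi.single v (ψ v) = ψ v • (Pi.single v 1 : V → ℝ) := by
        rw [← Pi.single_smul, smul_eq_mul, mul_one]
      rw [this, map_smul, inner_smul_left, h1 v, mul_zero]
    exact Subtype.ext (inner_self_eq_zero.1 h2)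
  have := LinearMap.finrank_le_finrank_of_injective hinj
  simpa using this

/-- A unit potential across an edge represents twice the coordinate functional on gradients. -/
theorem IsUnitPotential.inner_eq_two_mul_apply {u v : V} (h : G.Adj u v) {φ : V → ℝ}
    (hφ : IsUnitPotential G u v φ) {g : EuclideanSpace ℝ (V × V)}
    (hg : g ∈ LinearMap.range G.gradient) :
    inner ℝ g (G.gradient φ) = 2 * g (u, v) := by
  obtain ⟨ψ, rfl⟩ := hg
  rw [real_inner_comm, isUnitPotential_iff.1 hφ, gradient_apply_of_adj h]

/-- Foster's theorem in a subspace of gradients, as an upper bound. -/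
theorem sum_sq_norm_starProjection_le (W : Submodule ℝ (EuclideanSpace ℝ (V × V)))
    (hW : W ≤ LinearMap.range G.gradient) (F : Finset (V × V)) (φ : V × V → V → ℝ)
    (hF : ∀ p ∈ F, G.Adj p.1 p.2) (hφ : ∀ p ∈ F, IsUnitPotential G p.1 p.2 (φ p)) :
    ∑ p ∈ F, ‖W.starProjection (G.gradient (φ p))‖ ^ 2 ≤ 4 * Module.finrank ℝ W := by
  let b := stdOrthonormalBasis ℝ W
  have h1 : ∀ p ∈ F, ‖W.starProjection (G.gradient (φ p))‖ ^ 2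
      = ∑ i, 4 * (b i : EuclideanSpace ℝ (V × V)) p ^ 2 := by
    intro p hp
    have h2 : ‖W.starProjection (G.gradient (φ p))‖
        = ‖W.orthogonalProjectionOnto (G.gradient (φ p))‖ := rfl
    rw [h2, ← b.sum_sq_norm_inner_right]
    refine Finset.sum_congr rfl fun i _ => ?_
    rw [Submodule.inner_orthogonalProjectionOnto_eq_of_mem_left,
      (hφ p hp).inner_eq_two_mul_apply (hF p hp) (hW (b i).2), Real.norm_eq_abs, sq_abs]
    ring
  rw [Finset.sum_congr rfl h1, Finset.sum_comm]
  -- Each basis vector has unit norm, so its squared coordinates over `F` sum to at most 1.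
  have h3 : ∀ i, ∑ p ∈ F, 4 * (b i : EuclideanSpace ℝ (V × V)) p ^ 2 ≤ 4 := by
    intro i
    have h4 : ‖(b i : EuclideanSpace ℝ (V × V))‖ ^ 2 = 1 := by
      rw [Submodule.norm_coe, b.norm_eq_one, one_pow]
    rw [EuclideanSpace.norm_sq_eq] at h4
    simp only [Real.norm_eq_abs, sq_abs] at h4
    rw [← Finset.mul_sum]
    have := Finset.sum_le_sum_of_subset_of_nonneg (Finset.subset_univ F)
      fun p _ _ => sq_nonneg ((b i : EuclideanSpace ℝ (V × V)) p)
    linarith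
  refine (Finset.sum_le_sum fun i _ => h3 i).trans ?_
  simp [mul_comm]

/-- The edges whose resistance exceeds sixteen times the resistance from any vertex to its
representative have total resistance at most a constant times the number of representatives. Edges
are counted once in each direction. -/
theorem sum_effRes_long_edges_le [DecidableEq V] {Δ : ℝ} (hΔ : 0 ≤ Δ) (ρ : V → V)
    (hρ : ∀ x, effRes G x (ρ x) ≤ ENNReal.ofReal Δ) (F : Finset (V × V))
    (hF : ∀ p ∈ F, G.Adj p.1 p.2 ∧ 16 * Δ < (effRes G p.1 p.2).toReal) :
    ∑ p ∈ F, (effRes G p.1 p.2).toReal ≤ 8 * ((Finset.univ.image ρ).card : ℝ) := by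
  set W := G.harmonicGradients (Finset.univ.image ρ) with hW
  have hex : ∀ p : V × V, ∃ φ, p ∈ F → IsUnitPotential G p.1 p.2 φ := fun p => by
    by_cases hp : p ∈ F
    · obtain ⟨φ, hφ⟩ := exists_isUnitPotential (effRes_ne_top_of_adj (hF p hp).1)
      exact ⟨φ, fun _ => hφ⟩
    · exact ⟨0, fun h => absurd h hp⟩
  choose φ hφ using hex
  have hexρ : ∀ x, ∃ θ, IsUnitPotential G x (ρ x) θ := fun x =>
    exists_isUnitPotential (ne_top_of_le_ne_top ENNReal.ofReal_ne_top (hρ x))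
  choose θ hθ using hexρ
  have key : ∀ p ∈ F, (effRes G p.1 p.2).toReal ≤
      2 * ‖W.starProjection (G.gradient (φ p))‖ ^ 2 := by
    intro p hp
    obtain ⟨hadj, hlong⟩ := hF p hp
    have hnorm : ∀ x, ‖G.gradient (θ x)‖ ≤ √(2 * Δ) := by
      intro x
      apply Real.le_sqrt_of_sq_le
      rw [(hθ x).norm_sq]
      have := ENNReal.toReal_le_of_le_ofReal hΔ (hρ x)
      linarith
    -- The current is rerouted to run from representative to representative, so `q` is harmonic
    -- elsewhere. The change is two gradients of norm at most `√(2 * Δ)`.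
    set q := -θ p.1 + φ p + θ p.2 with hq
    have hqu : IsUnitPotential G (ρ p.1) (ρ p.2) q :=
      (((hθ p.1).neg.add (hφ p hp)).add (hθ p.2))
    have hqW : G.gradient q ∈ W := by
      refine ⟨LinearMap.mem_range_self _ _, fun v hv => ?_⟩
      rw [real_inner_comm, isUnitPotential_iff.1 hqu]
      have h1 : ∀ x, ρ x ≠ v := fun x h => hv (Finset.mem_image.2 ⟨x, Finset.mem_univ _, h⟩)
      simp [h1]
    have hdist : ‖G.gradient (φ p) - W.starProjection (G.gradient (φ p))‖ ≤ 2 * √(2 * Δ) := by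
      rw [Submodule.starProjection_minimal]
      refine (ciInf_le ⟨0, by rintro _ ⟨x, rfl⟩; exact norm_nonneg _⟩
        (⟨G.gradient q, hqW⟩ : W)).trans ?_
      have : G.gradient (φ p) - G.gradient q = G.gradient (θ p.1) - G.gradient (θ p.2) := by
        rw [hq]
        simp only [map_add, map_neg]
        abel
      rw [this]
      refine (norm_sub_le _ _).trans ?_
      linarith [hnorm p.1, hnorm p.2]
    have hn := (hφ p hp).norm_sq
    -- The squared norm is twice the resistance, hence above `32 * Δ`. This is where 16 comes from:
    -- the projection error is at most half the norm.
    have hlong' : 4 * √(2 * Δ) ≤ ‖G.gradient (φ p)‖ := by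
      apply le_of_sq_le_sq _ (norm_nonneg _)
      rw [hn, mul_pow, Real.sq_sqrt (by linarith)]
      linarith
    have htri := norm_sub_norm_le (G.gradient (φ p)) (W.starProjection (G.gradient (φ p)))
    have hhalf : ‖G.gradient (φ p)‖ ≤ 2 * ‖W.starProjection (G.gradient (φ p))‖ := by linarith
    have := pow_le_pow_left₀ (norm_nonneg _) hhalf 2
    rw [mul_pow, hn] at this
    linarith
  have h1 := sum_sq_norm_starProjection_le W (fun g hg => hg.1) F φ (fun p hp => (hF p hp).1) hφ
  have h2 : (Module.finrank ℝ W : ℝ) ≤ ((Finset.univ.image ρ).card : ℝ) := by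
    exact_mod_cast finrank_harmonicGradients_le (G := G) (Finset.univ.image ρ)
  have h3 := Finset.sum_le_sum key
  rw [← Finset.mul_sum] at h3
  linarith

end Foster

/-! ### The run of the ball carving algorithm -/

section Carving

theorem effDiam_le_of_forall_le {V : Type*} [Fintype V] {G : SimpleGraph V} {u : V} {P : Finset V} {r : ℝ}
    (hr : 0 ≤ r) (h : ∀ w ∈ P, effRes G u w ≤ ENNReal.ofReal r) :
    effDiam G P ≤ ENNReal.ofReal (2 * r) := by
  refine iSup₂_le fun a ha => iSup₂_le fun b hb => (effRes_triangle a u b).trans ?_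
  rw [two_mul, ENNReal.ofReal_add hr hr, effRes_comm a u]
  exact add_le_add (h a ha) (h b hb)

variable {V : Type*} [DecidableEq V]

/-- The output of the carving loop comes with centres that are far from each other. -/
theorem exists_centers_carve (comp : V → Finset V) (r : ℝ) (R : V → V → ℝ≥0∞)
    (hR : ∀ u, R u u = 0) :
    ∀ (n : ℕ) (L : List V) (V' : Finset V), L.length = n → (∀ w ∈ L, w ∈ V') →
      ∃ cs : List (V × Finset V), cs.map Prod.snd = carve comp r R L V' ∧
        (∀ p ∈ cs, p.1 ∈ L ∧ p.1 ∈ p.2 ∧ p.2 ⊆ V' ∧ (∀ w ∈ p.2, R p.1 w ≤ ENNReal.ofReal r) ∧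
          ∃ v ∈ comp p.1, ENNReal.ofReal (r / 2) < R p.1 v) ∧
        cs.Pairwise fun p q => Disjoint p.2 q.2 ∧ ENNReal.ofReal r < R p.1 q.1 := by
  classical
  intro n
  induction n using Nat.strong_induction_on with
  | _ n ih =>
  intro L V' hn hL
  match L, hn, hL with
  | [], _, _ => exact ⟨[], by simp [carve]⟩
  | u :: L, hn, hL =>
    have hlen : ∀ p : V → Bool, (L.filter p).length < n := fun p => by
      rw [← hn]
      exact Nat.lt_succ_of_le (List.length_filter_le _ _)
    rw [carve]
    split_ifs with h
    · obtain ⟨cs, h1, h2, h3⟩ := ih _ (hlen _) (L.filter fun w => w ∉ comp u) V' rfl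
        fun w hw => hL w (List.mem_cons_of_mem _ (List.mem_filter.1 hw).1)
      refine ⟨cs, h1, fun p hp => ⟨?_, (h2 p hp).2⟩, h3⟩
      exact List.mem_cons_of_mem _ (List.mem_filter.1 (h2 p hp).1).1
    · set P : Finset V := insert u (V'.filter fun w => R u w ≤ ENNReal.ofReal r) with hP
      have hLP : ∀ w ∈ L.filter fun w => w ∉ P, w ∈ V' \ P := by
        intro w hw
        rw [List.mem_filter] at hw
        exact Finset.mem_sdiff.2 ⟨hL w (List.mem_cons_of_mem _ hw.1), by simpa using hw.2⟩
      obtain ⟨cs, h1, h2, h3⟩ := ih _ (hlen _) (L.filter fun w => w ∉ P) (V' \ P) rfl hLP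
      refine ⟨(u, P) :: cs, by simp [h1], ?_, List.pairwise_cons.2 ⟨?_, h3⟩⟩
      · intro p hp
        rcases List.mem_cons.1 hp with rfl | hp
        · refine ⟨List.mem_cons_self, Finset.mem_insert_self _ _, ?_, ?_, ?_⟩
          · exact Finset.insert_subset (hL u List.mem_cons_self) (Finset.filter_subset _ _)
          · intro w hw
            rcases Finset.mem_insert.1 hw with rfl | hw
            · simp [hR]
            · exact (Finset.mem_filter.1 hw).2
          · rw [Finset.sup_le_iff] at h
            push Not at h
            exact h
        · obtain ⟨a, b, c, e⟩ := h2 p hp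
          exact ⟨List.mem_cons_of_mem _ (List.mem_filter.1 a).1, b,
            c.trans Finset.sdiff_subset, e⟩
      · intro q hq
        obtain ⟨a, b, c, e⟩ := h2 q hq
        refine ⟨Finset.disjoint_left.2 fun x hx hx' => (Finset.mem_sdiff.1 (c hx')).2 hx, ?_⟩
        -- A later centre was still in `V'` when `P` was removed, yet was not put into `P`, so it
        -- lies beyond radius `r`.
        obtain ⟨ha, ha'⟩ := Finset.mem_sdiff.1 (hLP _ a)
        by_contra! hle
        exact ha' (Finset.mem_insert_of_mem (Finset.mem_filter.2 ⟨ha, hle⟩))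

theorem exists_centers_ballCarving [Fintype V] (G : SimpleGraph V) (E' : Set (Sym2 V)) (r : ℝ)
    (order : List V) :
    ∃ cs : List (V × Finset V), cs.map Prod.snd = ballCarving G E' r (effRes G) order ∧
      (∀ p ∈ cs, (∀ w ∈ p.2, effRes G p.1 w ≤ ENNReal.ofReal r) ∧
        ∃ v, (G.deleteEdges E').Reachable p.1 v ∧ ENNReal.ofReal (r / 2) < effRes G p.1 v) ∧
      cs.Pairwise fun p q => Disjoint p.2 q.2 ∧ ENNReal.ofReal r < effRes G p.1 q.1 := by
  obtain ⟨cs, h1, h2, h3⟩ := exists_centers_carve (componentAvoiding G E') r (effRes G)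
    effRes_self _ order Finset.univ rfl (fun w _ => Finset.mem_univ w)
  refine ⟨cs, h1, fun p hp => ?_, h3⟩
  obtain ⟨-, -, -, h, v, hv, hv'⟩ := h2 p hp
  exact ⟨h, v, by simpa [componentAvoiding] using hv, hv'⟩

open Classical in
/-- If `E'` contains the edges of connectivity at most `d`, then every cut that separates two
vertices connected outside `E'` has more than `d` edges. -/
theorem lt_card_interedges_of_reachable_deleteEdges [Fintype V] {G : SimpleGraph V}
    {E' : Set (Sym2 V)} {d : ℝ}
    (hE : ∀ u v : V, G.Adj u v → (edgeConnectivity G u v : ℝ) ≤ d → s(u, v) ∈ E') {u v : V}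
    (huv : (G.deleteEdges E').Reachable u v) {S : Finset V} (hu : u ∈ S) (hv : v ∉ S) :
    d < (G.interedges S Sᶜ).card := by
  obtain ⟨p⟩ := huv
  -- The path leaves `S` along an edge outside `E'`. That edge has connectivity above `d`, and `S`
  -- is one of the cuts separating its ends.
  obtain ⟨e, -, h1, h2⟩ := p.exists_boundary_dart (S : Set V) hu hv
  have hadj := e.adj
  rw [SimpleGraph.deleteEdges_adj] at hadj
  have h3 : d < edgeConnectivity G e.fst e.snd := by
    by_contra! h
    exact hadj.2 (hE _ _ hadj.1 h)
  refine h3.trans_le ?_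
  have : edgeConnectivity G e.fst e.snd ≤ (G.interedges S Sᶜ).card := by
    unfold edgeConnectivity
    refine Nat.sInf_le ⟨S, h1, h2, ?_⟩
    congr!
  exact_mod_cast this

end Carving

/-! ### Counting the centres -/

section Counting

open MeasureTheory

/-- If every point of `T` lies in at least `d` of the sets `I p`, then their total length is at
least `d` times the length of `T`. -/
theorem ofReal_mul_volume_le_sum_of_cover {ι : Type*} (F : Finset ι) (I : ι → Set ℝ)
    [∀ t, DecidablePred fun p => t ∈ I p]
    (hI : ∀ p, MeasurableSet (I p)) {T : Set ℝ} (hT : MeasurableSet T) {d : ℝ}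
    (h : ∀ t ∈ T, d ≤ (F.filter fun p => t ∈ I p).card) :
    ENNReal.ofReal d * volume T ≤ ∑ p ∈ F, volume (I p) := by
  calc ENNReal.ofReal d * volume T = ∫⁻ _ in T, ENNReal.ofReal d := by
        rw [setLIntegral_const]
    _ ≤ ∫⁻ t in T, ∑ p ∈ F, (I p).indicator 1 t := by
        refine setLIntegral_mono' hT fun t ht => ?_
        have h1 : ∑ p ∈ F, (I p).indicator (1 : ℝ → ℝ≥0∞) t
            = ((F.filter fun p => t ∈ I p).card : ℝ≥0∞) := by
          rw [Finset.card_filter, Nat.cast_sum]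
          refine Finset.sum_congr rfl fun p _ => ?_
          by_cases hp : t ∈ I p <;> simp [hp]
        rw [h1]
        exact ENNReal.ofReal_le_of_le_toReal (by simpa using h t ht)
    _ ≤ ∫⁻ t, ∑ p ∈ F, (I p).indicator 1 t := setLIntegral_le_lintegral _ _
    _ = ∑ p ∈ F, volume (I p) := by
        rw [lintegral_finsetSum _ fun p _ => measurable_one.indicator (hI p)]
        exact Finset.sum_congr rfl fun p _ => lintegral_indicator_one (hI p)

variable {V : Type*} [Fintype V] {G : SimpleGraph V}

/-- The effective resistance from `u`, truncated at `β`. -/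
noncomputable def truncRes (G : SimpleGraph V) (u : V) (β : ℝ) (w : V) : ℝ :=
  (min (effRes G u w) (ENNReal.ofReal β)).toReal

/-- Truncation preserves the triangle inequality and keeps the values finite, even where `u` is
disconnected from `x` or `y`. -/
theorem truncRes_le_add {u x y : V} {β : ℝ} (h : effRes G x y ≠ ⊤) :
    truncRes G u β y ≤ truncRes G u β x + (effRes G x y).toReal := by
  have hx : min (effRes G u x) (ENNReal.ofReal β) ≠ ⊤ :=
    ne_top_of_le_ne_top ENNReal.ofReal_ne_top (min_le_right _ _)
  unfold truncRes
  rw [← ENNReal.toReal_add hx h]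
  refine ENNReal.toReal_mono (ENNReal.add_ne_top.2 ⟨hx, h⟩) ?_
  rw [min_add]
  exact min_le_min (effRes_triangle u x y) le_self_add

theorem truncRes_le_iff {u w : V} {β t : ℝ} (ht : 0 ≤ t) (htβ : t < β) :
    truncRes G u β w ≤ t ↔ effRes G u w ≤ ENNReal.ofReal t := by
  unfold truncRes
  rw [← ENNReal.le_ofReal_iff_toReal_le
    (ne_top_of_le_ne_top ENNReal.ofReal_ne_top (min_le_right _ _)) ht, min_le_iff]
  refine or_iff_left fun h => ?_
  rw [ENNReal.ofReal_le_ofReal_iff ht] at h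
  linarith

variable [DecidableEq V]

open Classical in
/-- The representatives of the vertices in the ball of radius `β / 4` around `u`. -/
noncomputable def nearReps (G : SimpleGraph V) (ρ : V → V) (β : ℝ) (u : V) : Finset V :=
  (Finset.univ.filter fun w => effRes G u w ≤ ENNReal.ofReal (β / 4)).image ρ

open Classical in
/-- The ordered pairs of adjacent vertices of resistance more than `ℓ`. -/
noncomputable def longEdges (G : SimpleGraph V) (ℓ : ℝ) : Finset (V × V) :=
  Finset.univ.filter fun p => G.Adj p.1 p.2 ∧ ℓ < (effRes G p.1 p.2).toReal

open Classical in
/-- If the ball around `u` meets few clusters and all cuts around it are large, then the long edges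
leaving vertices of the ball have large total resistance. -/
theorem mul_le_sum_effRes_near {Δ β d : ℝ} (hΔ : 0 ≤ Δ) (hβ : 0 < β) (hd : 0 ≤ d) {ρ : V → V}
    (hρ : ∀ x, effRes G x (ρ x) ≤ ENNReal.ofReal Δ) {u v : V}
    (huv : ENNReal.ofReal (β / 2) < effRes G u v)
    (hcut : ∀ S : Finset V, u ∈ S → v ∉ S → d ≤ (G.interedges S Sᶜ).card)
    (hN : 18 * Δ * (nearReps G ρ β u).card ≤ β / 8) :
    d * (β / 8) ≤ ∑ p ∈ (longEdges G (16 * Δ)).filter fun p =>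
      effRes G u p.1 ≤ ENNReal.ofReal (β / 4), (effRes G p.1 p.2).toReal := by
  set f := truncRes G u β with hf
  set F := (longEdges G (16 * Δ)).filter fun p => effRes G u p.1 ≤ ENNReal.ofReal (β / 4) with hF
  -- The bad thresholds. If `f x ≤ t < f y` on an edge of resistance at most `16 * Δ`, then `t` lies
  -- between `f x` and `f x + 16 * Δ`, and `f x` is within `Δ` of `f (ρ x)`.
  set B : Set ℝ := ⋃ s ∈ nearReps G ρ β u, Set.Icc (f s - Δ) (f s + 17 * Δ) with hB
  set T : Set ℝ := Set.Ico 0 (β / 4) \ B with hT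
  have hBm : MeasurableSet B := Finset.measurableSet_biUnion _ fun s _ => measurableSet_Icc
  have hTm : MeasurableSet T := measurableSet_Ico.diff hBm
  have hTvol : ENNReal.ofReal (β / 8) ≤ volume T := by
    refine le_trans ?_ le_measure_sdiff
    have h1 : volume B ≤ ENNReal.ofReal (β / 8) := by
      refine (measure_biUnion_finset_le _ _).trans ?_
      have h2 : ∀ s ∈ nearReps G ρ β u, volume (Set.Icc (f s - Δ) (f s + 17 * Δ))
          = ENNReal.ofReal (18 * Δ) := fun s _ => by
        rw [Real.volume_Icc]
        congr 1
        ring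
      rw [Finset.sum_congr rfl h2, Finset.sum_const, nsmul_eq_mul, ← ENNReal.ofReal_natCast,
        ← ENNReal.ofReal_mul (Nat.cast_nonneg _)]
      exact ENNReal.ofReal_le_ofReal (by linarith)
    refine le_trans ?_ (tsub_le_tsub_left h1 _)
    rw [Real.volume_Ico, ← ENNReal.ofReal_sub _ (by linarith)]
    exact ENNReal.ofReal_le_ofReal (by linarith)
  have hfρ : ∀ x, f (ρ x) ≤ f x + Δ ∧ f x ≤ f (ρ x) + Δ := by
    intro x
    have hne := ne_top_of_le_ne_top ENNReal.ofReal_ne_top (hρ x)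
    have hle := ENNReal.toReal_le_of_le_ofReal hΔ (hρ x)
    have h1 := truncRes_le_add (u := u) (β := β) hne
    have h2 := truncRes_le_add (u := u) (β := β) (x := ρ x) (y := x) (by rwa [effRes_comm])
    rw [effRes_comm] at h2
    exact ⟨by linarith, by linarith⟩
  have hcover : ∀ t ∈ T, d ≤ (F.filter fun p => t ∈ Set.Ico (f p.1) (f p.2)).card := by
    rintro t ⟨⟨ht0, ht⟩, htB⟩
    set S : Finset V := Finset.univ.filter fun w => f w ≤ t with hS
    have hmem : ∀ w, w ∈ S ↔ f w ≤ t := fun w => by simp [hS]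
    have hSu : u ∈ S := (hmem u).2 ((truncRes_le_iff ht0 (by linarith)).2 (by simp [effRes_self]))
    have hSv : v ∉ S := fun h => by
      have h1 := (truncRes_le_iff ht0 (by linarith)).1 ((hmem v).1 h)
      exact absurd (huv.trans_le (h1.trans (ENNReal.ofReal_le_ofReal (by linarith)))) (lt_irrefl _)
    refine (hcut S hSu hSv).trans ?_
    have hsub : G.interedges S Sᶜ ⊆ F.filter fun p => t ∈ Set.Ico (f p.1) (f p.2) := by
      rintro ⟨x, y⟩ hxy
      rw [SimpleGraph.mem_interedges_iff, Finset.mem_compl, hmem, hmem, not_le] at hxy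
      obtain ⟨hx, hy, hadj⟩ := hxy
      have hxnear := (truncRes_le_iff (G := G) (u := u) (w := x) (β := β) (t := β / 4)
        (by linarith) (by linarith)).1 (by linarith)
      have hs : ρ x ∈ nearReps G ρ β u :=
        Finset.mem_image_of_mem _ (Finset.mem_filter.2 ⟨Finset.mem_univ _, hxnear⟩)
      have hnot : t ∉ Set.Icc (f (ρ x) - Δ) (f (ρ x) + 17 * Δ) := fun h =>
        htB (Set.mem_biUnion hs h)
      have hgt : f (ρ x) + 17 * Δ < t := by
        by_contra! h
        exact hnot ⟨by linarith [(hfρ x).1], h⟩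
      have hlip := truncRes_le_add (u := u) (β := β) (effRes_ne_top_of_adj hadj)
      refine Finset.mem_filter.2 ⟨Finset.mem_filter.2 ⟨Finset.mem_filter.2
        ⟨Finset.mem_univ _, hadj, ?_⟩, hxnear⟩, hx, hy⟩
      change _ < (effRes G x y).toReal
      linarith [(hfρ x).2]
    exact_mod_cast Finset.card_le_card hsub
  have hmain := ofReal_mul_volume_le_sum_of_cover F (fun p => Set.Ico (f p.1) (f p.2))
    (fun p => measurableSet_Ico) hTm hcover
  -- The truncated resistance is Lipschitz, so an edge is crossed for a set of thresholds no longer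
  -- than its resistance.
  have hupper : ∑ p ∈ F, volume (Set.Ico (f p.1) (f p.2))
      ≤ ENNReal.ofReal (∑ p ∈ F, (effRes G p.1 p.2).toReal) := by
    rw [ENNReal.ofReal_sum_of_nonneg fun p _ => ENNReal.toReal_nonneg]
    refine Finset.sum_le_sum fun p hp => ?_
    rw [Real.volume_Ico]
    have hadj : G.Adj p.1 p.2 := (Finset.mem_filter.1 (Finset.mem_filter.1 hp).1).2.1
    have := truncRes_le_add (u := u) (β := β) (effRes_ne_top_of_adj hadj)
    exact ENNReal.ofReal_le_ofReal (by linarith)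
  have h := ((mul_le_mul_right hTvol (ENNReal.ofReal d)).trans hmain).trans hupper
  rw [← ENNReal.ofReal_mul hd, ENNReal.ofReal_le_ofReal_iff
    (Finset.sum_nonneg fun p _ => ENNReal.toReal_nonneg)] at h
  exact h

open Classical in
/-- The number of pairwise distant centres all of whose separating cuts are large. -/
theorem card_centers_le {Δ β d : ℝ} {k : ℕ} (hΔ : 0 ≤ Δ) (hβ : 0 < β) (hd : 0 < d) (hk : 1 ≤ k)
    (hΔβ : 18 * Δ * √k ≤ β / 8) {ρ : V → V}
    (hρ : ∀ x, effRes G x (ρ x) ≤ ENNReal.ofReal Δ) (hρk : (Finset.univ.image ρ).card ≤ k)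
    (A : Finset V) (hA : ∀ u ∈ A, ∀ u' ∈ A, u ≠ u' → ENNReal.ofReal β < effRes G u u')
    (hcut : ∀ u ∈ A, ∃ v, ENNReal.ofReal (β / 2) < effRes G u v ∧
      ∀ S : Finset V, u ∈ S → v ∉ S → d ≤ (G.interedges S Sᶜ).card) :
    (A.card : ℝ) ≤ √k + 64 * (k / (β * d)) := by
  have hk1 : (1 : ℝ) ≤ √k := Real.one_le_sqrt.2 (by exact_mod_cast hk)
  have hk' : (√k) * √k = k := Real.mul_self_sqrt (Nat.cast_nonneg _)
  have hΔ' : Δ ≤ β / 144 := by nlinarith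
  -- A common representative would put the two centres within `β / 2 + 2 * Δ ≤ β` of each other.
  have hdisj : ∀ u ∈ A, ∀ u' ∈ A, u ≠ u' → ∀ x x' : V,
      effRes G u x ≤ ENNReal.ofReal (β / 4) → effRes G u' x' ≤ ENNReal.ofReal (β / 4) →
      ρ x ≠ ρ x' := by
    intro u hu u' hu' hne x x' hx hx' he
    refine absurd (hA u hu u' hu' hne) (not_lt.2 ?_)
    have h1 := effRes_triangle (G := G) u x (ρ x)
    have h2 := effRes_triangle (G := G) u' x' (ρ x')
    have h3 := effRes_triangle (G := G) u (ρ x) u'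
    rw [effRes_comm (ρ x), he] at h3
    rw [he] at h1
    refine h3.trans ((add_le_add (h1.trans (add_le_add hx (he ▸ hρ x)))
      (h2.trans (add_le_add hx' (hρ x')))).trans ?_)
    rw [← ENNReal.ofReal_add (by linarith) hΔ, ← ENNReal.ofReal_add (by linarith) (by linarith)]
    exact ENNReal.ofReal_le_ofReal (by linarith)
  rw [← Finset.card_filter_add_card_filter_not (s := A)
    (fun u => √k ≤ ((nearReps G ρ β u).card : ℝ)), Nat.cast_add]
  apply add_le_add
  · set A₁ := A.filter fun u => √k ≤ ((nearReps G ρ β u).card : ℝ)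
    have h1 : ∑ u ∈ A₁, (nearReps G ρ β u).card ≤ k := by
      rw [← Finset.card_biUnion]
      · refine (Finset.card_le_card (Finset.biUnion_subset.2 fun u _ => ?_)).trans hρk
        exact Finset.image_subset_image (Finset.filter_subset _ _)
      · intro u hu u' hu' hne
        refine Finset.disjoint_left.2 fun s hs hs' => ?_
        obtain ⟨x, hx, rfl⟩ := Finset.mem_image.1 hs
        obtain ⟨x', hx', he⟩ := Finset.mem_image.1 hs'
        exact hdisj u (Finset.mem_filter.1 hu).1 u' (Finset.mem_filter.1 hu').1 hne x x'
          (Finset.mem_filter.1 hx).2 (Finset.mem_filter.1 hx').2 he.symm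
    have h2 : (A₁.card : ℝ) * √k ≤ k := by
      calc (A₁.card : ℝ) * √k = ∑ u ∈ A₁, √k := by simp
        _ ≤ ∑ u ∈ A₁, ((nearReps G ρ β u).card : ℝ) :=
            Finset.sum_le_sum fun u hu => (Finset.mem_filter.1 hu).2
        _ ≤ k := by exact_mod_cast h1
    exact le_of_mul_le_mul_right (h2.trans hk'.ge) (by linarith)
  -- Each of these centres uses up at least `d * (β / 8)` of a total budget of `8 * k`. No long edge
  -- is charged twice, since its tail is near only one centre.
  · set A₂ := A.filter fun u => ¬ √k ≤ ((nearReps G ρ β u).card : ℝ)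
    have h1 : ∀ u ∈ A₂, d * (β / 8) ≤ ∑ p ∈ (longEdges G (16 * Δ)).filter fun p =>
        effRes G u p.1 ≤ ENNReal.ofReal (β / 4), (effRes G p.1 p.2).toReal := by
      intro u hu
      obtain ⟨huA, hlt⟩ := Finset.mem_filter.1 hu
      obtain ⟨v, hv, hS⟩ := hcut u huA
      refine mul_le_sum_effRes_near hΔ hβ hd.le hρ hv hS ?_
      exact (mul_le_mul_of_nonneg_left (not_le.1 hlt).le (by linarith)).trans hΔβ
    have h2 : (A₂.card : ℝ) * (d * (β / 8)) ≤ 8 * k := by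
      calc (A₂.card : ℝ) * (d * (β / 8)) = ∑ u ∈ A₂, d * (β / 8) := by simp
        _ ≤ ∑ u ∈ A₂, ∑ p ∈ (longEdges G (16 * Δ)).filter fun p =>
              effRes G u p.1 ≤ ENNReal.ofReal (β / 4), (effRes G p.1 p.2).toReal :=
            Finset.sum_le_sum h1
        _ = ∑ p ∈ A₂.biUnion fun u => (longEdges G (16 * Δ)).filter fun p =>
              effRes G u p.1 ≤ ENNReal.ofReal (β / 4), (effRes G p.1 p.2).toReal := by
            rw [Finset.sum_biUnion]
            intro u hu u' hu' hne
            refine Finset.disjoint_left.2 fun p hp hp' => ?_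
            exact hdisj u (Finset.mem_filter.1 hu).1 u' (Finset.mem_filter.1 hu').1 hne p.1 p.1
              (Finset.mem_filter.1 hp).2 (Finset.mem_filter.1 hp').2 rfl
        _ ≤ ∑ p ∈ longEdges G (16 * Δ), (effRes G p.1 p.2).toReal :=
            Finset.sum_le_sum_of_subset_of_nonneg
              (Finset.biUnion_subset.2 fun u _ => Finset.filter_subset _ _)
              fun p _ _ => ENNReal.toReal_nonneg
        _ ≤ 8 * ((Finset.univ.image ρ).card : ℝ) :=
            sum_effRes_long_edges_le hΔ ρ hρ _ fun p hp => (Finset.mem_filter.1 hp).2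
        _ ≤ 8 * k := by
            have : ((Finset.univ.image ρ).card : ℝ) ≤ k := by exact_mod_cast hρk
            linarith
    rw [← mul_div_assoc, le_div_iff₀ (mul_pos hβ hd)]
    linarith

end Counting

/-! ### Cluster representatives and the final bound -/

theorem exists_representatives {V : Type*} [Fintype V] [DecidableEq V] (G : SimpleGraph V)
    (𝒞 : Finpartition (Finset.univ : Finset V)) {Δ : ℝ}
    (h : ∀ C ∈ 𝒞.parts, inducedEffDiam G C ≤ ENNReal.ofReal Δ) :
    ∃ ρ : V → V, (∀ x, effRes G x (ρ x) ≤ ENNReal.ofReal Δ) ∧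
      (Finset.univ.image ρ).card ≤ 𝒞.parts.card := by
  choose g hg using fun (C : Finset V) (hC : C ∈ 𝒞.parts) => 𝒞.nonempty_of_mem_parts hC
  have hpart : ∀ x, 𝒞.part x ∈ 𝒞.parts := fun x => 𝒞.part_mem.2 (Finset.mem_univ x)
  refine ⟨fun x => g (𝒞.part x) (hpart x), fun x => ?_, ?_⟩
  -- The induced diameter enters only here: by Rayleigh monotonicity it bounds resistances in `G`.
  · exact (effRes_le_inducedEffDiam G (𝒞.mem_part (Finset.mem_univ x)) (hg _ _)).trans
      (h _ (hpart x))
  · rw [← Finset.card_attach (s := 𝒞.parts)]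
    refine (Finset.card_le_card ?_).trans (Finset.card_image_le (f := fun C => g C.1 C.2))
    intro y hy
    obtain ⟨x, -, rfl⟩ := Finset.mem_image.1 hy
    exact Finset.mem_image.2 ⟨⟨_, hpart x⟩, Finset.mem_attach _ _, rfl⟩

theorem mainTheorem3 :
    ∃ (K : ℝ) (c : ℕ),
      ∀ (V : Type*) [Fintype V] [DecidableEq V] (G : SimpleGraph V) [DecidableRel G.Adj]
        (E' : Set (Sym2 V)) (_ : E' ⊆ G.edgeSet)
        (d : ℝ) (_ : 1 ≤ d) (_ : d ≤ (G.minDegree : ℝ))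
        (β : ℝ) (_ : 0 < β) (_ : β < 1 / Real.log (Fintype.card V))
        (k : ℕ) (_ : 1 ≤ k)
        (𝒞 : Finpartition (Finset.univ : Finset V)) (_ : 𝒞.parts.card = k)
        (Δ : ℝ) (_ : 0 < Δ) (_ : Δ < 1) (_ : Δ < β / (400 * Real.sqrt k))
        (_ : ∀ C ∈ 𝒞.parts, inducedEffDiam G C ≤ ENNReal.ofReal Δ)
        (_ : ∀ u v : V, G.Adj u v → (edgeConnectivity G u v : ℝ) ≤ d → s(u, v) ∈ E')
        (order : List V) (_ : order.Nodup) (_ : ∀ v : V, v ∈ order),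
        (ballCarving G E' β (effRes G) order).Pairwise Disjoint ∧
        (∀ P ∈ ballCarving G E' β (effRes G) order, effDiam G P ≤ ENNReal.ofReal (2 * β)) ∧
        (((ballCarving G E' β (effRes G) order).filter fun P => 1 < P.card).length : ℝ) ≤
          K * Real.log (Fintype.card V) ^ c * (Real.sqrt k + k / (β * d)) := by
  -- No logarithm is lost. The bound holds for all output sets, singletons included.
  refine ⟨64, 0, ?_⟩
  intro V _ _ G _ E' _ d hd1 _ β hβ _ k hk 𝒞 h𝒞 Δ hΔ _ hΔβ hdiam hE order _ _
  obtain ⟨cs, hcs, h1, h2⟩ := exists_centers_ballCarving G E' β order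
  refine ⟨?_, ?_, ?_⟩
  · rw [← hcs, List.pairwise_map]
    exact h2.imp fun h => h.1
  · intro P hP
    rw [← hcs] at hP
    obtain ⟨p, hp, rfl⟩ := List.mem_map.1 hP
    exact effDiam_le_of_forall_le hβ.le (h1 p hp).1
  · obtain ⟨ρ, hρ, hρk⟩ := exists_representatives G 𝒞 hdiam
    have hk1 : (1 : ℝ) ≤ √k := Real.one_le_sqrt.2 (by exact_mod_cast hk)
    have hd : 0 < d := by linarith
    have h3 : (cs.map Prod.fst).Pairwise fun u u' => ENNReal.ofReal β < effRes G u u' := by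
      rw [List.pairwise_map]
      exact h2.imp fun h => h.2
    have hnodup : (cs.map Prod.fst).Nodup := h3.imp fun {a b} h hab => by
      subst hab
      rw [effRes_self] at h
      exact not_lt_bot h
    have hcard := card_centers_le (G := G) (Δ := Δ) (d := d) hΔ.le hβ hd hk
      -- The requirement is `144 * Δ * √k ≤ β`, and the hypothesis supplies 400 in place of 144.
      (by rw [lt_div_iff₀ (by linarith)] at hΔβ; linarith) hρ (h𝒞 ▸ hρk)
      (cs.map Prod.fst).toFinset
      (fun u hu u' hu' hne => by
        have hsymm : Std.Symm fun u u' => ENNReal.ofReal β < effRes G u u' :=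
          ⟨fun a b h => by rwa [effRes_comm]⟩
        exact h3.forall (List.mem_toFinset.1 hu) (List.mem_toFinset.1 hu') hne)
      (fun u hu => by
        obtain ⟨p, hp, rfl⟩ := List.mem_map.1 (List.mem_toFinset.1 hu)
        obtain ⟨v, hv, hv'⟩ := (h1 p hp).2
        refine ⟨v, hv', fun S hS hS' => ?_⟩
        convert (lt_card_interedges_of_reachable_deleteEdges hE hv hS hS').le)
    rw [List.toFinset_card_of_nodup hnodup, List.length_map] at hcard
    have hlen : ((ballCarving G E' β (effRes G) order).filter fun P => 1 < P.card).length
        ≤ cs.length := by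
      refine (List.length_filter_le _ _).trans ?_
      rw [← hcs, List.length_map]
    have hlen' : (((ballCarving G E' β (effRes G) order).filter
        fun P => 1 < P.card).length : ℝ) ≤ cs.length := by exact_mod_cast hlen
    rw [pow_zero, mul_one, mul_add]
    linarith
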